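/- Let $a\in\mathbb R\setminus\{-1,1\}$ and $\delta>0$, let $\{\epsilon_t\}_{t\in\mathbb Z}$ be i.i.d. random variables with the Cauchy distribution with location $0$ and scale parameter $\delta$, and let $\{Z_t\}_{t\in\mathbb Z}$ be a strictly stationary process satisfying the (possibly non-causal) AR(1) equation $$Z_t = a Z_{t-1}+\epsilon_t \quad\text{almost surely, for every } t\in\mathbb Z .$$ Then $\{Z_t\}$ is geometrically $\alpha$-mixing: there are constants $C>0$ and $\rho\in(0,1)$ such that, for all integers $k\ge 0$, $$\alpha(k):=\sup_{t\in\mathbb Z}\ \sup\bigl\{\,|P(A\cap B)-P(A)P(B)| : A\in\sigma(Z_s, s\le t),\ B\in\sigma(Z_s, s\ge t+k)\,\bigr\}\le C\rho^k .$$ -/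

import Mathlib

open MeasureTheory ProbabilityTheory
open scoped NNReal

/-- A process `Z = (Z t)`, `t ∈ ℤ`, is strictly stationary under `P` if the law of the whole
process (a probability measure on `ℤ → ℝ`) is invariant under every time shift. -/
def StrictlyStationary {Ω : Type*} [MeasurableSpace Ω] (P : Measure Ω) (Z : ℤ → Ω → ℝ) : Prop :=
  ∀ h : ℤ, P.map (fun ω t => Z (t + h) ω) = P.map (fun ω t => Z t ω)

/-- The σ-algebra generated by `Z s`, `s ≤ t`. -/
def pastSigma {Ω : Type*} (Z : ℤ → Ω → ℝ) (t : ℤ) : MeasurableSpace Ω :=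
  ⨆ s : {s : ℤ // s ≤ t}, MeasurableSpace.comap (Z s) inferInstance

/-- The σ-algebra generated by `Z s`, `s ≥ t`. -/
def futureSigma {Ω : Type*} (Z : ℤ → Ω → ℝ) (t : ℤ) : MeasurableSpace Ω :=
  ⨆ s : {s : ℤ // t ≤ s}, MeasurableSpace.comap (Z s) inferInstance

/-- The numbers `|P(A ∩ B) - P(A) P(B)|` with `A ∈ σ(Z s, s ≤ t)` and `B ∈ σ(Z s, s ≥ t + k)`,
over all times `t`. -/
def alphaMixingDefects {Ω : Type*} [MeasurableSpace Ω] (P : Measure Ω) (Z : ℤ → Ω → ℝ) (k : ℕ) :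
    Set ℝ :=
  {x | ∃ (t : ℤ) (A B : Set Ω), MeasurableSet[pastSigma Z t] A ∧
    MeasurableSet[futureSigma Z (t + k)] B ∧ x = |P.real (A ∩ B) - P.real A * P.real B|}

/-- The strong mixing (Rosenblatt) coefficient
`α(k) = sup_t sup { |P(A ∩ B) - P(A) P(B)| : A ∈ σ(Z s, s ≤ t), B ∈ σ(Z s, s ≥ t + k) }`. -/
noncomputable def alphaMixingCoeff {Ω : Type*} [MeasurableSpace Ω] (P : Measure Ω)
    (Z : ℤ → Ω → ℝ) (k : ℕ) : ℝ :=
  sSup (alphaMixingDefects P Z k)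

/-- The supremum defining `alphaMixingCoeff` is over a nonempty bounded set. -/
theorem alphaMixingDefects_nonempty_bddAbove {Ω : Type*} [MeasurableSpace Ω] (P : Measure Ω)
    [IsProbabilityMeasure P] (Z : ℤ → Ω → ℝ) (k : ℕ) :
    (alphaMixingDefects P Z k).Nonempty ∧ BddAbove (alphaMixingDefects P Z k) := by
  refine ⟨⟨_, 0, ∅, ∅, @MeasurableSet.empty _ (pastSigma Z 0),
    @MeasurableSet.empty _ (futureSigma Z (0 + k)), rfl⟩, 1, ?_⟩
  rintro x ⟨t, A, B, -, -, rfl⟩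
  have h1 : 0 ≤ P.real (A ∩ B) := measureReal_nonneg
  have h2 : P.real (A ∩ B) ≤ 1 := measureReal_le_one
  have h3 : 0 ≤ P.real A * P.real B := mul_nonneg measureReal_nonneg measureReal_nonneg
  have h4 : P.real A * P.real B ≤ 1 :=
    mul_le_one₀ measureReal_le_one measureReal_nonneg measureReal_le_one
  rw [abs_le]
  constructor <;> linarith

/-- Geometric α-mixing: `α(k) ≤ C ρ ^ k` for all `k`, with some `C > 0` and `ρ ∈ (0, 1)`. -/
def GeometricallyAlphaMixing {Ω : Type*} [MeasurableSpace Ω] (P : Measure Ω)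
    (Z : ℤ → Ω → ℝ) : Prop :=
  ∃ C ρ : ℝ, 0 < C ∧ 0 < ρ ∧ ρ < 1 ∧ ∀ k : ℕ, alphaMixingCoeff P Z k ≤ C * ρ ^ k

/-! Suppose `|a| < 1`. Iterating the recursion gives `Z t = a ^ n * Z (t - n)` plus a finite noise
sum. Since all `Z s` have the same law, the first term tends to 0 in probability, so `Z t` is a.s.
the causal series and is a function of the noise up to `t`.

At time `u = t + k`, `k > 0`, the past enters the future only through the term `a ^ k * Z t` added
to the fresh noise `ε u`. Dropping it decouples the future from the past. Conditionally on all other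
noise, it is a translation of a Cauchy variable, so the cost is at most `K * E|a ^ k * Z t| ^
(1/2)`, of order `|a| ^ (k/2)` (`measure_inter_futurePath`). The exponent 1/2 is used because Cauchy
variables have no first moment but a finite half moment, and `x ↦ x ^ (1/2)` is subadditive.

If `|a| > 1`, time reversal gives an autoregression with coefficient `a⁻¹`, and the mixing
coefficient is symmetric in past and future. -/

open Filter Topology
open scoped ENNReal

/-- The measure `ν` moves by at most `K |x| ^ (1/2)` in total variation under a translation
by `x`. -/
def TranslationHolder (ν : Measure ℝ) (K : ℝ≥0∞) : Prop :=
  ∀ (x : ℝ) (D : Set ℝ), MeasurableSet D →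
    ν ((fun u => u + x) ⁻¹' D) ≤ ν D + K * ‖x‖ₑ ^ (1 / 2 : ℝ)

/-! ### Translation bound and half moment of the Cauchy law. -/

section Noise

theorem TranslationHolder.map_const_mul {ν : Measure ℝ} {K : ℝ≥0∞} (h : TranslationHolder ν K)
    {c : ℝ} (hc : c ≠ 0) :
    TranslationHolder (ν.map (fun u => c * u)) (K * ‖c⁻¹‖ₑ ^ (1 / 2 : ℝ)) := by
  intro x D hD
  have hm : Measurable fun u : ℝ => c * u := by fun_prop
  rw [Measure.map_apply hm (hD.preimage (by fun_prop)), Measure.map_apply hm hD]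
  have := h (c⁻¹ * x) _ (hD.preimage hm)
  rw [enorm_mul, ENNReal.mul_rpow_of_nonneg _ _ (by norm_num), ← mul_assoc] at this
  convert this using 2
  ext u
  simp [mul_add, hc]

/-- Expand `u = (u - x) + x` in `u ^ 2 + γ ^ 2`; AM-GM on `|u - x| * γ` absorbs the cross term. -/
theorem cauchyPDFReal_sub_le (γ : ℝ≥0) (hγ : 0 < γ) (x u : ℝ) :
    cauchyPDFReal 0 γ (u - x) ≤ (1 + (|x| / γ + (|x| / γ) ^ 2)) * cauchyPDFReal 0 γ u := by
  have hg : (0 : ℝ) < γ := hγ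
  simp only [cauchyPDFReal_def, sub_zero]
  rw [mul_left_comm]
  refine mul_le_mul_of_nonneg_left ?_ (by positivity)
  rw [← div_eq_mul_inv, ← one_div, div_le_div_iff₀ (by positivity) (by positivity), one_mul]
  set y := |x| / (γ : ℝ) with hy
  have hx : |x| = y * γ := by rw [hy]; field_simp
  have hy0 : 0 ≤ y := by positivity
  have h1 : 2 * (u - x) * x ≤ y * ((u - x) ^ 2 + γ ^ 2) := by
    calc 2 * (u - x) * x ≤ |2 * (u - x) * x| := le_abs_self _
      _ = y * (2 * |u - x| * γ) := by rw [abs_mul, abs_mul, hx, abs_two]; ring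
      _ ≤ y * ((u - x) ^ 2 + γ ^ 2) := by
          refine mul_le_mul_of_nonneg_left ?_ hy0
          rw [← sq_abs (u - x)]
          exact two_mul_le_add_sq _ _
  have h2 : x ^ 2 ≤ y ^ 2 * ((u - x) ^ 2 + γ ^ 2) := by
    rw [← sq_abs x, hx, mul_pow]
    exact mul_le_mul_of_nonneg_left (by nlinarith [sq_nonneg (u - x)]) (by positivity)
  nlinarith

/-- Merges the density bound (small shifts) with the trivial bound 1 (large shifts) into a single
half-power bound. -/
theorem min_one_add_sq_le_sqrt {y : ℝ} (hy : 0 ≤ y) : min 1 (y + y ^ 2) ≤ 2 * √y := by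
  have hs := Real.sqrt_nonneg y
  have hq := Real.sq_sqrt hy
  rcases le_total y 1 with h | h
  · have h1 : √y ≤ 1 := Real.sqrt_le_one.mpr h
    refine (min_le_right _ _).trans ?_
    nlinarith
  · have h1 : 1 ≤ √y := Real.one_le_sqrt.mpr h
    exact (min_le_left _ _).trans (by linarith)

theorem translationHolder_cauchyMeasure (γ : ℝ≥0) (hγ : 0 < γ) :
    TranslationHolder (cauchyMeasure 0 γ) (ENNReal.ofReal (2 / √γ)) := by
  intro x D hD
  have hg : (0 : ℝ) < γ := hγ
  set y := |x| / (γ : ℝ) with hy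
  have hy0 : 0 ≤ y := by positivity
  have hr : ENNReal.ofReal (2 / √γ) * ‖x‖ₑ ^ (1 / 2 : ℝ) = ENNReal.ofReal (2 * √y) := by
    rw [Real.enorm_eq_ofReal_abs, ENNReal.ofReal_rpow_of_nonneg (abs_nonneg _) (by norm_num),
      ← Real.sqrt_eq_rpow, ← ENNReal.ofReal_mul (by positivity), hy, Real.sqrt_div (abs_nonneg _)]
    congr 1
    ring
  rw [hr]
  have key : cauchyMeasure 0 γ ((fun u => u + x) ⁻¹' D) ≤
      ENNReal.ofReal (1 + (y + y ^ 2)) * cauchyMeasure 0 γ D := by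
    rw [cauchyMeasure_of_scale_ne_zero 0 hγ.ne', withDensity_apply _ (hD.preimage (by fun_prop)),
      withDensity_apply _ hD, ← lintegral_indicator (hD.preimage (by fun_prop)),
      ← lintegral_sub_right_eq_self _ x, ← lintegral_const_mul _ (measurable_cauchyPDF 0 γ),
      ← lintegral_indicator hD]
    refine lintegral_mono fun u => ?_
    by_cases hu : u ∈ D
    · simp only [Set.indicator, Set.mem_preimage, sub_add_cancel, hu, if_true, cauchyPDF]
      rw [← ENNReal.ofReal_mul (by positivity)]
      exact ENNReal.ofReal_le_ofReal (cauchyPDFReal_sub_le γ hγ x u)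
    · simp [Set.indicator, hu]
  have h1 : cauchyMeasure 0 γ D ≤ 1 := prob_le_one
  have h2 : cauchyMeasure 0 γ ((fun u => u + x) ⁻¹' D) ≤ 1 := prob_le_one
  have h3 : cauchyMeasure 0 γ ((fun u => u + x) ⁻¹' D) ≤
      cauchyMeasure 0 γ D + ENNReal.ofReal (y + y ^ 2) := by
    refine key.trans ?_
    rw [ENNReal.ofReal_add zero_le_one (by positivity), add_mul, ENNReal.ofReal_one, one_mul]
    gcongr
    exact mul_le_of_le_one_right' h1
  have h4 := ENNReal.ofReal_le_ofReal (min_one_add_sq_le_sqrt hy0)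
  rw [ENNReal.ofReal_min] at h4
  rcases min_le_iff.mp h4 with h | h
  · exact h2.trans ((by simpa using h : (1 : ℝ≥0∞) ≤ _).trans le_add_self)
  · exact h3.trans (by gcongr)

theorem lintegral_enorm_rpow_half_cauchyMeasure_ne_top (γ : ℝ≥0) (hγ : 0 < γ) :
    ∫⁻ x, ‖x‖ₑ ^ (1 / 2 : ℝ) ∂(cauchyMeasure 0 γ) ≠ ∞ := by
  have hg : (0 : ℝ) < γ := hγ
  -- The last factor comes from `(1 + |x|) ^ 2 ≤ 2 * (1 + x ^ 2) ≤ 2 * (1 + γ⁻²) * (x ^ 2 + γ ^ 2)`.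
  set c : ℝ := Real.pi⁻¹ * γ * (2 * (1 + ((γ : ℝ) ^ 2)⁻¹)) with hc
  have hi : Integrable (fun x : ℝ => c * (1 + ‖x‖) ^ (-(3 / 2) : ℝ)) :=
    (integrable_one_add_norm (by norm_num)).const_mul c
  rw [cauchyMeasure_of_scale_ne_zero 0 hγ.ne',
    lintegral_withDensity_eq_lintegral_mul _ (measurable_cauchyPDF 0 γ) (by fun_prop)]
  refine ne_top_of_le_ne_top hi.lintegral_lt_top.ne (lintegral_mono fun x => ?_)
  simp only [Pi.mul_apply, cauchyPDF]
  rw [Real.enorm_eq_ofReal_abs, ENNReal.ofReal_rpow_of_nonneg (abs_nonneg _) (by norm_num),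
    ← ENNReal.ofReal_mul (by rw [cauchyPDFReal_def]; positivity)]
  refine ENNReal.ofReal_le_ofReal ?_
  rw [cauchyPDFReal_def, hc, mul_assoc, mul_assoc _ _ ((1 + ‖x‖) ^ (-(3 / 2) : ℝ)), Real.norm_eq_abs]
  refine mul_le_mul_of_nonneg_left ?_ (by positivity)
  have hx := abs_nonneg x
  have h1 : |x| ^ (1 / 2 : ℝ) ≤ (1 + |x|) ^ (1 / 2 : ℝ) :=
    Real.rpow_le_rpow hx (by linarith) (by norm_num)
  have h2 : (1 + |x|) ^ (-(3 / 2) : ℝ) = (1 + |x|) ^ (1 / 2 : ℝ) * ((1 + |x|) ^ 2)⁻¹ := by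
    rw [← Real.rpow_natCast, ← Real.rpow_neg (by positivity), ← Real.rpow_add (by positivity)]
    norm_num
  have h3 : ((x - 0) ^ 2 + (γ : ℝ) ^ 2)⁻¹ ≤ 2 * (1 + ((γ : ℝ) ^ 2)⁻¹) * ((1 + |x|) ^ 2)⁻¹ := by
    rw [← div_eq_mul_inv, inv_eq_one_div, div_le_div_iff₀ (by positivity) (by positivity), sub_zero,
      ← sq_abs x, one_mul]
    have h4 : ((γ : ℝ) ^ 2)⁻¹ * (γ : ℝ) ^ 2 = 1 := inv_mul_cancel₀ (by positivity)
    have h5 : 0 ≤ ((γ : ℝ) ^ 2)⁻¹ * |x| ^ 2 := by positivity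
    nlinarith [sq_nonneg (|x| - 1), sq_nonneg (γ : ℝ)]
  rw [h2]
  calc _ ≤ 2 * (1 + ((γ : ℝ) ^ 2)⁻¹) * ((1 + |x|) ^ 2)⁻¹ * (1 + |x|) ^ (1 / 2 : ℝ) := by gcongr
    _ = _ := by ring

end Noise

/-! ### Random translations of an independent variable. -/

section Coupling

variable {Ω : Type*} [MeasurableSpace Ω] {P : Measure Ω} [IsProbabilityMeasure P]

/-- By Fubini, `Y` may be frozen at `y`; the shift `g y` is then constant and the translation bound
applies to each slice of `C`. -/
theorem measure_add_mem_le {E : Type*} [MeasurableSpace E] {Y : Ω → E} {e : Ω → ℝ}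
    (hY : Measurable Y) (he : Measurable e) (hYe : IndepFun Y e P) {K : ℝ≥0∞}
    (hK : TranslationHolder (P.map e) K) {g : E → ℝ} (hg : Measurable g) {C : Set (E × ℝ)}
    (hC : MeasurableSet C) :
    P {ω | (Y ω, e ω + g (Y ω)) ∈ C} ≤
      P {ω | (Y ω, e ω) ∈ C} + K * ∫⁻ ω, ‖g (Y ω)‖ₑ ^ (1 / 2 : ℝ) ∂P := by
  have hmap := (indepFun_iff_map_prod_eq_prod_map_map hY.aemeasurable he.aemeasurable).mp hYe
  have : IsProbabilityMeasure (P.map e) := Measure.isProbabilityMeasure_map he.aemeasurable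
  have hT : Measurable fun p : E × ℝ => (p.1, p.2 + g p.1) := by fun_prop
  have h1 : P {ω | (Y ω, e ω + g (Y ω)) ∈ C} =
      ((P.map Y).prod (P.map e)) ((fun p : E × ℝ => (p.1, p.2 + g p.1)) ⁻¹' C) := by
    rw [← hmap, Measure.map_apply (hY.prodMk he) (hC.preimage hT)]
    rfl
  have h2 : P {ω | (Y ω, e ω) ∈ C} = ((P.map Y).prod (P.map e)) C := by
    rw [← hmap, Measure.map_apply (hY.prodMk he) hC]
    rfl
  have h3 : ∫⁻ ω, ‖g (Y ω)‖ₑ ^ (1 / 2 : ℝ) ∂P = ∫⁻ y, ‖g y‖ₑ ^ (1 / 2 : ℝ) ∂(P.map Y) := by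
    rw [lintegral_map (by fun_prop) hY]
  rw [h1, h2, h3, Measure.prod_apply (hC.preimage hT), Measure.prod_apply hC,
    ← lintegral_const_mul _ (by fun_prop), ← lintegral_add_right _ (by fun_prop)]
  exact lintegral_mono fun y => hK (g y) _ (hC.preimage (by fun_prop))

/-- The shear by `g` is undone by the shear by `-g`. -/
theorem measure_mem_le_add {E : Type*} [MeasurableSpace E] {Y : Ω → E} {e : Ω → ℝ}
    (hY : Measurable Y) (he : Measurable e) (hYe : IndepFun Y e P) {K : ℝ≥0∞}
    (hK : TranslationHolder (P.map e) K) {g : E → ℝ} (hg : Measurable g) {C : Set (E × ℝ)}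
    (hC : MeasurableSet C) :
    P {ω | (Y ω, e ω) ∈ C} ≤
      P {ω | (Y ω, e ω + g (Y ω)) ∈ C} + K * ∫⁻ ω, ‖g (Y ω)‖ₑ ^ (1 / 2 : ℝ) ∂P := by
  have hT : Measurable fun p : E × ℝ => (p.1, p.2 + g p.1) := by fun_prop
  simpa using measure_add_mem_le hY he hYe hK hg.neg (hC.preimage hT)

end Coupling

/-! ### The causal moving average solution. -/

theorem ENNReal.tsum_rpow_half_le (f : ℕ → ℝ≥0∞) :
    (∑' j, f j) ^ (1 / 2 : ℝ) ≤ ∑' j, f j ^ (1 / 2 : ℝ) := by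
  have h1 : Tendsto (fun n => (∑ j ∈ Finset.range n, f j) ^ (1 / 2 : ℝ)) atTop
      (𝓝 ((∑' j, f j) ^ (1 / 2 : ℝ))) :=
    (ENNReal.continuous_rpow_const.tendsto _).comp (ENNReal.tendsto_nat_tsum f)
  refine le_of_tendsto' h1 fun n => le_trans ?_ (ENNReal.sum_le_tsum (Finset.range n))
  induction n with
  | zero => simp
  | succ n ih =>
    rw [Finset.sum_range_succ, Finset.sum_range_succ]
    exact (ENNReal.rpow_add_le_add_rpow _ _ (by norm_num) (by norm_num)).trans (by gcongr)

section Autoregression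

variable {Ω : Type*} {mΩ : MeasurableSpace Ω} {P : Measure Ω}
  {a : ℝ} {ε Z : ℤ → Ω → ℝ}

/-- The σ-algebra generated by `ε r`, `r ∈ S`. -/
@[reducible]
def noiseSigma {Ω : Type*} (ε : ℤ → Ω → ℝ) (S : Set ℤ) : MeasurableSpace Ω :=
  ⨆ r ∈ S, MeasurableSpace.comap (ε r) inferInstance

theorem noiseSigma_le (hε : ∀ t, Measurable (ε t)) (S : Set ℤ) : noiseSigma ε S ≤ mΩ :=
  iSup₂_le fun r _ => (hε r).comap_le

theorem noiseSigma_mono {S T : Set ℤ} (h : S ⊆ T) : noiseSigma ε S ≤ noiseSigma ε T :=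
  biSup_mono h

theorem measurable_noiseSigma {S : Set ℤ} {r : ℤ} (hr : r ∈ S) :
    Measurable[noiseSigma ε S] (ε r) :=
  measurable_iff_comap_le.mpr (le_iSup₂_of_le r hr le_rfl)

theorem indep_noiseSigma (hε : ∀ t, Measurable (ε t)) (hind : iIndepFun ε P) {S T : Set ℤ}
    (h : Disjoint S T) : Indep (noiseSigma ε S) (noiseSigma ε T) P :=
  indep_iSup_of_disjoint (fun r => (hε r).comap_le) hind h

/-- The partial sums `∑_{j < n} a ^ j ε_{t - j}` of the moving average solution. -/
def movingSum (a : ℝ) (ε : ℤ → Ω → ℝ) (t : ℤ) (n : ℕ) (ω : Ω) : ℝ :=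
  ∑ j ∈ Finset.range n, a ^ j * ε (t - j) ω

theorem measurable_movingSum {S : Set ℤ} {t : ℤ} {n : ℕ} (h : ∀ j < n, t - (j : ℤ) ∈ S) :
    Measurable[noiseSigma ε S] (movingSum a ε t n) := by
  refine Finset.measurable_fun_sum (m := noiseSigma ε S) _ fun j hj => ?_
  exact (measurable_noiseSigma (h j (Finset.mem_range.mp hj))).const_mul _

theorem movingSum_add (t : ℤ) (m n : ℕ) (ω : Ω) :
    movingSum a ε t (m + n) ω = movingSum a ε t m ω + a ^ m * movingSum a ε (t - m) n ω := by
  simp only [movingSum, Finset.sum_range_add, Finset.mul_sum]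
  congr 1
  refine Finset.sum_congr rfl fun j _ => ?_
  rw [pow_add, mul_assoc]
  push_cast
  rw [sub_sub]

/-- The causal moving average solution `∑_j a ^ j ε_{t - j}`, written as an upper limit. -/
noncomputable def causalSolution (a : ℝ) (ε : ℤ → Ω → ℝ) (t : ℤ) (ω : Ω) : ℝ :=
  limsup (fun n => movingSum a ε t n ω) atTop

/-- The upper limit is measurable for the noise σ-algebra itself, with no null set to discard; this
gives exact independence later. -/
theorem measurable_causalSolution (t : ℤ) :
    Measurable[noiseSigma ε (Set.Iic t)] (causalSolution a ε t) := by
  refine Measurable.limsup (mδ := noiseSigma ε (Set.Iic t)) fun n => ?_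
  exact measurable_movingSum fun j _ => by simp

theorem eq_pow_mul_add_movingSum (hrec : ∀ t, ∀ᵐ ω ∂P, Z t ω = a * Z (t - 1) ω + ε t ω)
    (t : ℤ) (n : ℕ) :
    ∀ᵐ ω ∂P, Z t ω = a ^ n * Z (t - n) ω + movingSum a ε t n ω := by
  filter_upwards [ae_all_iff.mpr hrec] with ω hω
  induction n with
  | zero => simp [movingSum]
  | succ n ih =>
    rw [ih, hω (t - n), movingSum_add]
    simp [movingSum, sub_sub]
    ring

theorem lintegral_tsum_enorm_le (hε : ∀ t, Measurable (ε t)) {M : ℝ≥0∞}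
    (hM : ∀ t, ∫⁻ ω, ‖ε t ω‖ₑ ^ (1 / 2 : ℝ) ∂P ≤ M) (t : ℤ) :
    ∫⁻ ω, (∑' j : ℕ, ‖a ^ j * ε (t - j) ω‖ₑ) ^ (1 / 2 : ℝ) ∂P ≤
      (1 - ‖a‖ₑ ^ (1 / 2 : ℝ))⁻¹ * M := by
  calc _ ≤ ∫⁻ ω, ∑' j : ℕ, (‖a‖ₑ ^ (1 / 2 : ℝ)) ^ j * ‖ε (t - j) ω‖ₑ ^ (1 / 2 : ℝ) ∂P := by
        refine lintegral_mono fun ω => (ENNReal.tsum_rpow_half_le _).trans_eq ?_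
        refine tsum_congr fun j => ?_
        rw [enorm_mul, enorm_pow, ENNReal.mul_rpow_of_nonneg _ _ (by norm_num),
          ← ENNReal.rpow_natCast, ← ENNReal.rpow_natCast, ← ENNReal.rpow_mul, ← ENNReal.rpow_mul,
          mul_comm (j : ℝ)]
    _ = ∑' j : ℕ, (‖a‖ₑ ^ (1 / 2 : ℝ)) ^ j * ∫⁻ ω, ‖ε (t - j) ω‖ₑ ^ (1 / 2 : ℝ) ∂P := by
        rw [lintegral_tsum fun j => by fun_prop]
        exact tsum_congr fun j => lintegral_const_mul _ (by fun_prop)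
    _ ≤ ∑' j : ℕ, (‖a‖ₑ ^ (1 / 2 : ℝ)) ^ j * M :=
        ENNReal.tsum_le_tsum fun j => by gcongr; exact hM _
    _ = _ := by rw [ENNReal.tsum_mul_right, ENNReal.tsum_geometric]

theorem enorm_rpow_half_lt_one (ha : |a| < 1) : ‖a‖ₑ ^ (1 / 2 : ℝ) < 1 :=
  ENNReal.rpow_lt_one (by rwa [Real.enorm_eq_ofReal_abs, ENNReal.ofReal_lt_one]) (by norm_num)

theorem geometric_mul_ne_top (ha : |a| < 1) {M : ℝ≥0∞} (hM : M ≠ ∞) :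
    (1 - ‖a‖ₑ ^ (1 / 2 : ℝ))⁻¹ * M ≠ ∞ :=
  ENNReal.mul_ne_top (ENNReal.inv_ne_top.mpr (tsub_pos_of_lt (enorm_rpow_half_lt_one ha)).ne') hM

theorem ae_summable_movingSum (hε : ∀ t, Measurable (ε t)) (ha : |a| < 1) {M : ℝ≥0∞} (hM' : M ≠ ∞)
    (hM : ∀ t, ∫⁻ ω, ‖ε t ω‖ₑ ^ (1 / 2 : ℝ) ∂P ≤ M) (t : ℤ) :
    ∀ᵐ ω ∂P, Summable fun j : ℕ => a ^ j * ε (t - j) ω := by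
  have h := ne_top_of_le_ne_top (geometric_mul_ne_top ha hM') (lintegral_tsum_enorm_le hε hM t)
  filter_upwards [ae_lt_top (by fun_prop) h] with ω hω
  refine Summable.of_enorm fun htop => ?_
  rw [htop, ENNReal.top_rpow_of_pos (by norm_num)] at hω
  exact hω.false

theorem ae_tendsto_movingSum (hε : ∀ t, Measurable (ε t)) (ha : |a| < 1) {M : ℝ≥0∞} (hM' : M ≠ ∞)
    (hM : ∀ t, ∫⁻ ω, ‖ε t ω‖ₑ ^ (1 / 2 : ℝ) ∂P ≤ M) (t : ℤ) :
    ∀ᵐ ω ∂P, causalSolution a ε t ω = ∑' j : ℕ, a ^ j * ε (t - j) ω ∧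
      Tendsto (fun n => movingSum a ε t n ω) atTop (𝓝 (causalSolution a ε t ω)) := by
  filter_upwards [ae_summable_movingSum hε ha hM' hM t] with ω hω
  have h : causalSolution a ε t ω = ∑' j : ℕ, a ^ j * ε (t - j) ω :=
    hω.hasSum.tendsto_sum_nat.limsup_eq
  exact ⟨h, h ▸ hω.hasSum.tendsto_sum_nat⟩

theorem lintegral_causalSolution_le (hε : ∀ t, Measurable (ε t)) (ha : |a| < 1) {M : ℝ≥0∞}
    (hM' : M ≠ ∞) (hM : ∀ t, ∫⁻ ω, ‖ε t ω‖ₑ ^ (1 / 2 : ℝ) ∂P ≤ M) (t : ℤ) :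
    ∫⁻ ω, ‖causalSolution a ε t ω‖ₑ ^ (1 / 2 : ℝ) ∂P ≤ (1 - ‖a‖ₑ ^ (1 / 2 : ℝ))⁻¹ * M := by
  refine le_trans (lintegral_mono_ae ?_) (lintegral_tsum_enorm_le hε hM t)
  filter_upwards [ae_tendsto_movingSum hε ha hM' hM t] with ω hω
  rw [hω.1]
  gcongr
  exact enorm_tsum_le_tsum_enorm

/-- `Z t` minus the partial sum is a.s. `a ^ n * Z (t - n)`, with the law of `a ^ n * Z 0`, hence
tends to 0 in measure; limits in measure are a.s. unique. -/
theorem ae_eq_causalSolution [IsProbabilityMeasure P] (hε : ∀ t, Measurable (ε t)) (ha : |a| < 1) {M : ℝ≥0∞} (hM' : M ≠ ∞)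
    (hM : ∀ t, ∫⁻ ω, ‖ε t ω‖ₑ ^ (1 / 2 : ℝ) ∂P ≤ M) (hZ : ∀ t, Measurable (Z t))
    (hlaw : ∀ t, P.map (Z t) = P.map (Z 0))
    (hrec : ∀ t, ∀ᵐ ω ∂P, Z t ω = a * Z (t - 1) ω + ε t ω) (t : ℤ) :
    Z t =ᵐ[P] causalSolution a ε t := by
  have hmeas : ∀ n, Measurable (movingSum a ε t n) := fun n =>
    Finset.measurable_fun_sum _ fun j _ => (hε _).const_mul _
  refine tendstoInMeasure_ae_unique (f := movingSum a ε t) (u := atTop) ?_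
    (tendstoInMeasure_of_tendsto_ae (fun n => (hmeas n).aestronglyMeasurable)
      ((ae_tendsto_movingSum hε ha hM' hM t).mono fun ω h => h.2))
  have h0 : TendstoInMeasure P (fun (n : ℕ) ω => a ^ n * Z 0 ω) atTop (fun _ => (0 : ℝ)) := by
    refine tendstoInMeasure_of_tendsto_ae
      (fun n => ((hZ 0).const_mul _).aestronglyMeasurable) (ae_of_all _ fun ω => ?_)
    simpa using (tendsto_pow_atTop_nhds_zero_of_abs_lt_one ha).mul_const (Z 0 ω)
  intro η hη
  refine (h0 η hη).congr fun n => ?_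
  have hS : MeasurableSet {z : ℝ | η ≤ edist (a ^ n * z) 0} :=
    measurableSet_le measurable_const (by fun_prop)
  have h1 : P {ω | η ≤ edist (a ^ n * Z 0 ω) 0} = P {ω | η ≤ edist (a ^ n * Z (t - n) ω) 0} := by
    have := congrArg (fun μ => μ {z : ℝ | η ≤ edist (a ^ n * z) 0}) (hlaw (t - n))
    simp only [Measure.map_apply (hZ _) hS] at this
    exact this.symm
  rw [h1]
  refine measure_congr ?_
  filter_upwards [eq_pow_mul_add_movingSum hrec t n] with ω hω
  refine propext (Iff.of_eq (congrArg (η ≤ ·) ?_))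
  rw [hω, edist_comm, edist_eq_enorm_sub, edist_eq_enorm_sub]
  simp

end Autoregression

/-! ### Decoupling past and future. -/

section Mixing

variable {Ω : Type*} {mΩ : MeasurableSpace Ω} {P : Measure Ω} {a : ℝ} {ε Z : ℤ → Ω → ℝ}

/-- The path `(Z s)`, `s ≥ u`, of the autoregression that starts from the value `v` at time `u`. -/
def futurePath (a : ℝ) (ε : ℤ → Ω → ℝ) (u : ℤ) (v : Ω → ℝ) (ω : Ω) : {s : ℤ // u ≤ s} → ℝ :=
  fun s => a ^ (s.1 - u).toNat * v ω + movingSum a ε s (s.1 - u).toNat ω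

theorem measurable_futurePath_movingSum (t : ℤ) (k : ℕ) :
    Measurable[noiseSigma ε (Set.Ioi t)]
      (futurePath a ε (t + k) (movingSum a ε (t + k) k)) := by
  refine @measurable_pi_lambda _ _ _ (noiseSigma ε (Set.Ioi t)) _ _ fun s => ?_
  have hs := s.2
  refine Measurable.add (m := noiseSigma ε (Set.Ioi t)) (Measurable.const_mul ?_ _) ?_
  · exact measurable_movingSum fun j hj => by simp only [Set.mem_Ioi]; omega
  · exact measurable_movingSum fun j hj => by simp only [Set.mem_Ioi]; omega

theorem exists_preimage_of_measurableSet_pastSigma {t : ℤ} {A : Set Ω}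
    (hA : MeasurableSet[pastSigma Z t] A) :
    ∃ A₀ : Set ({s : ℤ // s ≤ t} → ℝ), MeasurableSet A₀ ∧ A = (fun ω s => Z s.1 ω) ⁻¹' A₀ := by
  rw [pastSigma, ← MeasurableSpace.comap_process_pi fun (s : {s : ℤ // s ≤ t}) => Z s.1] at hA
  obtain ⟨A₀, h₀, h⟩ := hA
  exact ⟨A₀, h₀, h.symm⟩

theorem exists_preimage_of_measurableSet_futureSigma {t : ℤ} {B : Set Ω}
    (hB : MeasurableSet[futureSigma Z t] B) :
    ∃ B₀ : Set ({s : ℤ // t ≤ s} → ℝ), MeasurableSet B₀ ∧ B = (fun ω s => Z s.1 ω) ⁻¹' B₀ := by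
  rw [futureSigma, ← MeasurableSpace.comap_process_pi fun (s : {s : ℤ // t ≤ s}) => Z s.1] at hB
  obtain ⟨B₀, h₀, h⟩ := hB
  exact ⟨B₀, h₀, h.symm⟩

/-- The noise `ε u` enters the path only through its starting value, so adding `a ^ k * X` there
amounts to translating `ε u`. All other ingredients, including `A`, depend on noise at times other
than `u`. -/
theorem measure_inter_futurePath [IsProbabilityMeasure P] (hε : ∀ t, Measurable (ε t))
    (hind : iIndepFun ε P) {K : ℝ≥0∞} (hK : ∀ t, TranslationHolder (P.map (ε t)) K) {t u : ℤ}
    {k : ℕ} (hk : 0 < k) (hu : u = t + k) {X : Ω → ℝ} (hX : Measurable[noiseSigma ε (Set.Iic t)] X) {A : Set Ω}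
    (hA : MeasurableSet[noiseSigma ε (Set.Iic t)] A) {B₀ : Set ({s : ℤ // u ≤ s} → ℝ)}
    (hB₀ : MeasurableSet B₀) :
    P (A ∩ futurePath a ε (u) (fun ω => a ^ k * X ω + movingSum a ε (u) k ω) ⁻¹' B₀) ≤
        P (A ∩ futurePath a ε (u) (movingSum a ε (u) k) ⁻¹' B₀) +
          K * ∫⁻ ω, ‖a ^ k * X ω‖ₑ ^ (1 / 2 : ℝ) ∂P ∧
      P (A ∩ futurePath a ε (u) (movingSum a ε (u) k) ⁻¹' B₀) ≤
        P (A ∩ futurePath a ε (u) (fun ω => a ^ k * X ω + movingSum a ε (u) k ω) ⁻¹' B₀) +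
          K * ∫⁻ ω, ‖a ^ k * X ω‖ₑ ^ (1 / 2 : ℝ) ∂P := by
  obtain ⟨k, rfl⟩ : ∃ k', k = k' + 1 := ⟨k - 1, by omega⟩
  have hut : t < u := by omega
  have hle : noiseSigma ε (Set.Iic t) ≤ noiseSigma ε {u}ᶜ := noiseSigma_mono fun r hr => by
    simp only [Set.mem_Iic] at hr
    simp only [Set.mem_compl_iff, Set.mem_singleton_iff]
    omega
  set S : Ω → ℝ := movingSum a ε (u - (1 : ℕ)) k with hS
  set R : Ω → {s : ℤ // u ≤ s} → ℝ := fun ω s => movingSum a ε s.1 (s.1 - u).toNat ω with hR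
  have hsum : ∀ ω, movingSum a ε u (k + 1) ω = ε u ω + a * S ω := fun ω => by
    rw [add_comm k 1, movingSum_add]
    simp [movingSum, hS]
  have hSm : Measurable[noiseSigma ε {u}ᶜ] S := measurable_movingSum fun j hj => by
    simp only [Set.mem_compl_iff, Set.mem_singleton_iff]
    omega
  have hRm : Measurable[noiseSigma ε {u}ᶜ] R := by
    refine @measurable_pi_lambda _ _ _ (noiseSigma ε {u}ᶜ) _ _ fun s => measurable_movingSum fun j hj => ?_
    have := s.2
    simp only [Set.mem_compl_iff, Set.mem_singleton_iff]
    omega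
  have hAm : Measurable[noiseSigma ε {u}ᶜ] fun ω => ω ∈ A := (@measurableSet_setOfPred _ (noiseSigma ε {u}ᶜ) _).mp (hle _ hA)
  -- The event `A` is carried as a `Prop`-valued coordinate, so that intersecting with it becomes a
  -- condition on `Y`.
  set Y : Ω → Prop × ℝ × ℝ × ({s : ℤ // u ≤ s} → ℝ) := fun ω => (ω ∈ A, X ω, S ω, R ω) with hY
  have hYm : Measurable[noiseSigma ε {u}ᶜ] Y :=
    hAm.prodMk ((hX.mono hle le_rfl).prodMk (hSm.prodMk hRm))
  have hYe : IndepFun Y (ε u) P := by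
    have h0 : Indep (noiseSigma ε {u}ᶜ) (noiseSigma ε {u}) P :=
      indep_noiseSigma hε hind (Set.disjoint_compl_left_iff_subset.mpr subset_rfl)
    have h1 : MeasurableSpace.comap (ε u) inferInstance ≤ noiseSigma ε {u} :=
      (measurable_noiseSigma (Set.mem_singleton u)).comap_le
    rw [IndepFun_iff_Indep]
    exact indep_of_indep_of_le_left (indep_of_indep_of_le_right h0 h1) hYm.comap_le
  set C : Set ((Prop × ℝ × ℝ × ({s : ℤ // u ≤ s} → ℝ)) × ℝ) :=
    {p | p.1.1} ∩ (fun p (s : {s : ℤ // u ≤ s}) =>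
      a ^ (s.1 - u).toNat * (p.2 + a * p.1.2.2.1) + p.1.2.2.2 s) ⁻¹' B₀ with hC
  have hCm : MeasurableSet C := by
    refine MeasurableSet.inter (measurableSet_setOfPred.mpr (by fun_prop)) (hB₀.preimage ?_)
    fun_prop
  have hg : Measurable fun y : Prop × ℝ × ℝ × ({s : ℤ // u ≤ s} → ℝ) => a ^ (k + 1) * y.2.1 := by
    fun_prop
  have hY' : Measurable Y := hYm.mono (noiseSigma_le hε _) le_rfl
  have e1 : A ∩ futurePath a ε u (fun ω => a ^ (k + 1) * X ω + movingSum a ε u (k + 1) ω) ⁻¹' B₀ =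
      {ω | (Y ω, ε u ω + a ^ (k + 1) * (Y ω).2.1) ∈ C} := by
    ext ω
    refine and_congr Iff.rfl (iff_of_eq (congrArg (· ∈ B₀) (funext fun s => ?_)))
    simp only [hY, hR, futurePath, hsum]
    ring
  have e2 : A ∩ futurePath a ε u (movingSum a ε u (k + 1)) ⁻¹' B₀ = {ω | (Y ω, ε u ω) ∈ C} := by
    ext ω
    refine and_congr Iff.rfl (iff_of_eq (congrArg (· ∈ B₀) (funext fun s => ?_)))
    simp only [hY, hR, futurePath, hsum]
  rw [e1, e2]
  exact ⟨measure_add_mem_le hY' (hε u) hYe (hK u) hg hCm,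
    measure_mem_le_add hY' (hε u) hYe (hK u) hg hCm⟩

theorem ae_eq_futurePath (hrec : ∀ t, ∀ᵐ ω ∂P, Z t ω = a * Z (t - 1) ω + ε t ω) {t : ℤ}
    {X : Ω → ℝ} (hX : Z t =ᵐ[P] X) (k : ℕ) :
    ∀ᵐ ω ∂P, (fun s : {s : ℤ // t + k ≤ s} => Z s.1 ω) =
      futurePath a ε (t + k) (fun ω => a ^ k * X ω + movingSum a ε (t + k) k ω) ω := by
  filter_upwards [hX, eq_pow_mul_add_movingSum hrec (t + k) k,
    ae_all_iff.mpr fun s => ae_all_iff.mpr fun n => eq_pow_mul_add_movingSum hrec s n]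
    with ω h1 h2 h3
  funext s
  have hs := s.2
  rw [futurePath, h3 s.1 (s.1 - (t + k)).toNat, show s.1 - ((s.1 - (t + k)).toNat : ℤ) = t + k by omega,
    h2, add_sub_cancel_right, h1]

/-- With `F` the decoupled future event, independent of `A'`, the defect is `(P(A' ∩ B') - P(A' ∩
F)) + P(A') * (P(F) - P(B'))`. Each part costs one translation error, hence the factor 2. -/
theorem abs_measureReal_inter_sub_le [IsProbabilityMeasure P] (hε : ∀ t, Measurable (ε t))
    (hind : iIndepFun ε P) {K : ℝ≥0∞} (hK' : K ≠ ∞)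
    (hK : ∀ t, TranslationHolder (P.map (ε t)) K) (ha : |a| < 1) {M : ℝ≥0∞} (hM' : M ≠ ∞)
    (hM : ∀ t, ∫⁻ ω, ‖ε t ω‖ₑ ^ (1 / 2 : ℝ) ∂P ≤ M) (hZ : ∀ t, Measurable (Z t))
    (hlaw : ∀ t, P.map (Z t) = P.map (Z 0))
    (hrec : ∀ t, ∀ᵐ ω ∂P, Z t ω = a * Z (t - 1) ω + ε t ω) {t : ℤ} {k : ℕ} (hk : 0 < k)
    {A B : Set Ω} (hA : MeasurableSet[pastSigma Z t] A)
    (hB : MeasurableSet[futureSigma Z (t + k)] B) :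
    |P.real (A ∩ B) - P.real A * P.real B| ≤
      2 * (K * ((1 - ‖a‖ₑ ^ (1 / 2 : ℝ))⁻¹ * M)).toReal * (√|a|) ^ k := by
  set D := K * ((1 - ‖a‖ₑ ^ (1 / 2 : ℝ))⁻¹ * M) with hD
  have hD' : D ≠ ∞ := ENNReal.mul_ne_top hK' (geometric_mul_ne_top ha hM')
  have hsol := ae_eq_causalSolution hε ha hM' hM hZ hlaw hrec
  obtain ⟨A₀, hA₀, rfl⟩ := exists_preimage_of_measurableSet_pastSigma hA
  obtain ⟨B₀, hB₀, rfl⟩ := exists_preimage_of_measurableSet_futureSigma hB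
  set X := causalSolution a ε t with hX
  set A' : Set Ω := (fun ω (s : {s : ℤ // s ≤ t}) => causalSolution a ε s.1 ω) ⁻¹' A₀ with hA'
  set B' : Set Ω :=
    futurePath a ε (t + k) (fun ω => a ^ k * X ω + movingSum a ε (t + k) k ω) ⁻¹' B₀ with hB'
  set F : Set Ω := futurePath a ε (t + k) (movingSum a ε (t + k) k) ⁻¹' B₀ with hF
  have hAA : (fun ω (s : {s : ℤ // s ≤ t}) => Z s.1 ω) ⁻¹' A₀ =ᵐ[P] A' := by
    filter_upwards [ae_all_iff.mpr hsol] with ω hω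
    exact congrArg (· ∈ A₀) (funext fun s : {s : ℤ // s ≤ t} => hω s.1)
  have hBB : (fun ω (s : {s : ℤ // t + k ≤ s}) => Z s.1 ω) ⁻¹' B₀ =ᵐ[P] B' := by
    filter_upwards [ae_eq_futurePath hrec (hsol t) k] with ω hω
    exact congrArg (· ∈ B₀) hω
  rw [measureReal_congr (hAA.inter hBB), measureReal_congr hAA, measureReal_congr hBB]
  have hXm : Measurable[noiseSigma ε (Set.Iic t)] X := measurable_causalSolution t
  have hAm : MeasurableSet[noiseSigma ε (Set.Iic t)] A' := by
    refine @measurable_pi_lambda _ _ _ (noiseSigma ε (Set.Iic t)) _ _ (fun s => ?_) _ hA₀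
    exact (measurable_causalSolution s.1).mono
      (noiseSigma_mono (Set.Iic_subset_Iic.mpr s.2)) le_rfl
  have hFm : MeasurableSet[noiseSigma ε (Set.Ioi t)] F := measurable_futurePath_movingSum t k hB₀
  have hAF : P.real (A' ∩ F) = P.real A' * P.real F := by
    have h : Disjoint (Set.Iic t) (Set.Ioi t) := Set.disjoint_left.mpr fun r h1 h2 =>
      (not_lt.mpr (Set.mem_Iic.mp h1)) h2
    simp only [Measure.real]
    rw [(Indep_iff _ _ _).mp (indep_noiseSigma hε hind h) A' F hAm hFm, ENNReal.toReal_mul]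
  have hE : K * ∫⁻ ω, ‖a ^ k * X ω‖ₑ ^ (1 / 2 : ℝ) ∂P ≤ ENNReal.ofReal (D.toReal * (√|a|) ^ k) := by
    have h1 : ∀ ω, ‖a ^ k * X ω‖ₑ ^ (1 / 2 : ℝ) =
        ENNReal.ofReal ((√|a|) ^ k) * ‖X ω‖ₑ ^ (1 / 2 : ℝ) := fun ω => by
      rw [enorm_mul, enorm_pow, ENNReal.mul_rpow_of_nonneg _ _ (by norm_num),
        Real.enorm_eq_ofReal_abs a, ← ENNReal.ofReal_pow (abs_nonneg a),
        ENNReal.ofReal_rpow_of_nonneg (by positivity) (by norm_num),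
        ← Real.rpow_pow_comm (abs_nonneg a), ← Real.sqrt_eq_rpow]
    simp only [h1]
    rw [lintegral_const_mul' _ _ ENNReal.ofReal_ne_top, ENNReal.ofReal_mul ENNReal.toReal_nonneg,
      ENNReal.ofReal_toReal hD', hD, mul_left_comm, mul_comm]
    gcongr
    exact lintegral_causalSolution_le hε ha hM' hM t
  have hreal : ∀ {U V : Set Ω}, P U ≤ P V + K * ∫⁻ ω, ‖a ^ k * X ω‖ₑ ^ (1 / 2 : ℝ) ∂P →
      P.real U ≤ P.real V + D.toReal * (√|a|) ^ k := fun {U V} h => by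
    have h' := h.trans (add_le_add_right hE _)
    have := ENNReal.toReal_mono (by finiteness) h'
    rwa [ENNReal.toReal_add (by finiteness) (by finiteness),
      ENNReal.toReal_ofReal (by positivity)] at this
  have c1 := measure_inter_futurePath (a := a) hε hind hK hk rfl hXm hAm hB₀
  have c2 := measure_inter_futurePath (a := a) hε hind hK hk rfl hXm
    (@MeasurableSet.univ _ (noiseSigma ε (Set.Iic t))) hB₀
  rw [Set.univ_inter, Set.univ_inter] at c2
  have i1 := hreal c1.1
  have i2 := hreal c1.2
  have i3 := hreal c2.1
  have i4 := hreal c2.2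
  have hA0 : 0 ≤ P.real A' := measureReal_nonneg
  have hA1 : P.real A' ≤ 1 := measureReal_le_one
  rw [hAF] at i1 i2
  have j1 : P.real A' * (P.real F - P.real B') ≤ D.toReal * (√|a|) ^ k :=
    (mul_le_mul_of_nonneg_left (by linarith) hA0).trans
      (mul_le_of_le_one_left (by positivity) hA1)
  have j2 : P.real A' * (P.real B' - P.real F) ≤ D.toReal * (√|a|) ^ k :=
    (mul_le_mul_of_nonneg_left (by linarith) hA0).trans
      (mul_le_of_le_one_left (by positivity) hA1)
  rw [abs_le]
  constructor <;> nlinarith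

theorem geometricallyAlphaMixing_of_abs_lt_one [IsProbabilityMeasure P]
    (hε : ∀ t, Measurable (ε t)) (hind : iIndepFun ε P) {K : ℝ≥0∞} (hK' : K ≠ ∞)
    (hK : ∀ t, TranslationHolder (P.map (ε t)) K) (ha : |a| < 1) {M : ℝ≥0∞} (hM' : M ≠ ∞)
    (hM : ∀ t, ∫⁻ ω, ‖ε t ω‖ₑ ^ (1 / 2 : ℝ) ∂P ≤ M) (hZ : ∀ t, Measurable (Z t))
    (hlaw : ∀ t, P.map (Z t) = P.map (Z 0))
    (hrec : ∀ t, ∀ᵐ ω ∂P, Z t ω = a * Z (t - 1) ω + ε t ω) :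
    GeometricallyAlphaMixing P Z := by
  set D := 2 * (K * ((1 - ‖a‖ₑ ^ (1 / 2 : ℝ))⁻¹ * M)).toReal with hD
  have hD0 : 0 ≤ D := by positivity
  -- The `1` covers `k = 0`, where there is no fresh noise; the maximum with `1 / 2` keeps the rate
  -- positive when `a = 0`.
  refine ⟨1 + D, max (1 / 2) √|a|, by linarith, lt_max_of_lt_left (by norm_num),
    max_lt (by norm_num) ((Real.sqrt_lt' one_pos).mpr (by simpa using ha)), fun k => ?_⟩
  have hne := alphaMixingDefects_nonempty_bddAbove P Z k
  refine csSup_le hne.1 ?_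
  rintro x ⟨t, A, B, hA, hB, rfl⟩
  rcases Nat.eq_zero_or_pos k with rfl | hk
  · have h1 : 0 ≤ P.real (A ∩ B) := measureReal_nonneg
    have h2 : P.real (A ∩ B) ≤ 1 := measureReal_le_one
    have h3 : 0 ≤ P.real A * P.real B := by positivity
    have h4 : P.real A * P.real B ≤ 1 :=
      mul_le_one₀ measureReal_le_one measureReal_nonneg measureReal_le_one
    rw [pow_zero, abs_le]
    constructor <;> linarith
  · refine (abs_measureReal_inter_sub_le hε hind hK' hK ha hM' hM hZ hlaw hrec hk hA hB).trans ?_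
    gcongr
    · linarith
    · exact le_max_right _ _

/-! ### Time reversal and conclusion. -/

theorem pastSigma_comp_neg (Z : ℤ → Ω → ℝ) (t : ℤ) :
    pastSigma (fun s => Z (-s)) t = futureSigma Z (-t) := by
  refine le_antisymm (iSup_le fun s => ?_) (iSup_le fun s => ?_)
  · exact le_iSup_of_le (⟨-s.1, neg_le_neg s.2⟩ : {s : ℤ // -t ≤ s}) le_rfl
  · refine le_iSup_of_le (⟨-s.1, neg_le.mp s.2⟩ : {s : ℤ // s ≤ t}) ?_
    simp

theorem futureSigma_comp_neg (Z : ℤ → Ω → ℝ) (t : ℤ) :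
    futureSigma (fun s => Z (-s)) t = pastSigma Z (-t) := by
  have h := pastSigma_comp_neg (fun s => Z (-s)) (-t)
  simpa using h.symm

theorem alphaMixingDefects_subset_comp_neg (P : Measure Ω) (Z : ℤ → Ω → ℝ) (k : ℕ) :
    alphaMixingDefects P Z k ⊆ alphaMixingDefects P (fun s => Z (-s)) k := by
  rintro x ⟨t, A, B, hA, hB, rfl⟩
  refine ⟨-(t + k), B, A, ?_, ?_, ?_⟩
  · rwa [pastSigma_comp_neg, neg_neg]
  · rwa [futureSigma_comp_neg, show -(-(t + (k : ℤ)) + k) = t by ring]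
  · rw [Set.inter_comm, mul_comm]

theorem GeometricallyAlphaMixing.of_comp_neg [IsProbabilityMeasure P]
    (h : GeometricallyAlphaMixing P fun s => Z (-s)) : GeometricallyAlphaMixing P Z := by
  obtain ⟨C, ρ, hC, hρ, hρ', h⟩ := h
  refine ⟨C, ρ, hC, hρ, hρ', fun k => le_trans ?_ (h k)⟩
  exact csSup_le_csSup (alphaMixingDefects_nonempty_bddAbove P _ k).2
    (alphaMixingDefects_nonempty_bddAbove P Z k).1 (alphaMixingDefects_subset_comp_neg P Z k)

theorem StrictlyStationary.map_eq (h : StrictlyStationary P Z) (hZ : ∀ t, Measurable (Z t))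
    (t : ℤ) : P.map (Z t) = P.map (Z 0) := by
  have h1 := congrArg (fun μ => μ.map fun x : ℤ → ℝ => x 0) (h t)
  rw [Measure.map_map (measurable_pi_apply 0) (measurable_pi_lambda _ fun s => hZ (s + t)),
    Measure.map_map (measurable_pi_apply 0) (measurable_pi_lambda _ hZ)] at h1
  simpa [Function.comp_def] using h1

end Mixing

theorem mainTheorem6 {Ω : Type*} [MeasurableSpace Ω] (P : Measure Ω) [IsProbabilityMeasure P]
    (a : ℝ) (ha : a ≠ -1) (ha' : a ≠ 1) (δ : ℝ≥0) (hδ : 0 < δ)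
    (ε Z : ℤ → Ω → ℝ)
    (hε_meas : ∀ t, Measurable (ε t))
    (hε_indep : iIndepFun ε P)
    (hε_law : ∀ t, P.map (ε t) = cauchyMeasure 0 δ)
    (hZ_meas : ∀ t, Measurable (Z t))
    (hZ_stat : StrictlyStationary P Z)
    (hZ_rec : ∀ t, ∀ᵐ ω ∂P, Z t ω = a * Z (t - 1) ω + ε t ω) :
    GeometricallyAlphaMixing P Z := by
  have hK := translationHolder_cauchyMeasure δ hδ
  have hMtop := lintegral_enorm_rpow_half_cauchyMeasure_ne_top δ hδ
  set M := ∫⁻ x, ‖x‖ₑ ^ (1 / 2 : ℝ) ∂(cauchyMeasure 0 δ) with hMdef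
  have hM : ∀ t, ∫⁻ ω, ‖ε t ω‖ₑ ^ (1 / 2 : ℝ) ∂P = M := fun t => by
    rw [hMdef, ← hε_law t, lintegral_map (by fun_prop) (hε_meas t)]
  have hlaw := hZ_stat.map_eq hZ_meas
  rcases lt_or_ge |a| 1 with h1 | h1
  · exact geometricallyAlphaMixing_of_abs_lt_one hε_meas hε_indep ENNReal.ofReal_ne_top
      (fun t => (hε_law t).symm ▸ hK) h1 hMtop (fun t => (hM t).le) hZ_meas hlaw hZ_rec
  · have ha1 : 1 < |a| := lt_of_le_of_ne h1 fun h => by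
      rcases eq_or_eq_neg_of_abs_eq h.symm with h | h
      · exact ha' h
      · exact ha h
    have ha0 : a ≠ 0 := by
      rintro rfl
      norm_num at ha1
    have hc : -a⁻¹ ≠ 0 := by simpa using ha0
    -- Solving `Z (1 - t) = a * Z (-t) + ε (1 - t)` for `Z (-t)` gives the reversed recursion, with
    -- noise `-a⁻¹ * ε (1 - t)`.
    refine GeometricallyAlphaMixing.of_comp_neg
      (geometricallyAlphaMixing_of_abs_lt_one (a := a⁻¹) (ε := fun t ω => -a⁻¹ * ε (1 - t) ω)
        (K := ENNReal.ofReal (2 / √δ) * ‖(-a⁻¹)⁻¹‖ₑ ^ (1 / 2 : ℝ))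
        (M := ‖-a⁻¹‖ₑ ^ (1 / 2 : ℝ) * M) (fun t => (hε_meas _).const_mul _) ?_ (by finiteness) ?_
        ?_ (ENNReal.mul_ne_top (by finiteness) hMtop) ?_ (fun t => hZ_meas _)
        (fun t => by rw [hlaw, neg_zero]) ?_)
    · exact (hε_indep.precomp (g := fun t : ℤ => 1 - t) sub_right_injective).comp
        (fun _ u => -a⁻¹ * u) fun _ => by fun_prop
    · intro t
      have h := hK.map_const_mul hc
      rw [← hε_law (1 - t), Measure.map_map (by fun_prop) (hε_meas _)] at h
      exact h
    · rw [abs_inv]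
      exact inv_lt_one_of_one_lt₀ ha1
    · intro t
      simp only [enorm_mul, ENNReal.mul_rpow_of_nonneg _ _ (by norm_num : (0 : ℝ) ≤ 1 / 2)]
      rw [lintegral_const_mul _ (by fun_prop), hM]
    · intro t
      filter_upwards [hZ_rec (1 - t)] with ω hω
      rw [show -(t - 1) = 1 - t by ring, hω, show 1 - t - 1 = -t by ring]
      field_simp
      ring
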